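/- For a permutation $a=(a_1,\dots,a_n)$ of $[n]=\{1,\dots,n\}$ let $S(a)$ be the set of all distinct sums $\sum_{i=u}^{v}a_i$ with $1\le u\le v\le n$. For a natural number $M$, say that $a$ has complexity at most $M$ if there is a partition $[n]=\bigcup_{j=1}^{M}I_j$ into $M$ pairwise disjoint (possibly empty) intervals, together with real constants $b_j,c_j$ with $|b_j|\le M$, such that $a_i=i\,b_j+c_j$ for every $j\in\{1,\dots,M\}$ and every $i\in I_j$. Fix $M$. Then, for permutations $a$ of $[n]$ of complexity at most $M$, as $n\to\infty$, one has $|S(a)|=o(n^2)$, and yet $|S(a)|=\Omega(n^{2-\delta})$ for every $\delta>0$, with rates depending only on $M$ and $\delta$. That is: 1. for every $\varepsilon>0$ there is $N=N(M,\varepsilon)$ such that $|S(a)|\le\varepsilon n^2$ for every $n\ge N$ and every permutation $a$ of $[n]$ of complexity at most $M$; 2. for every real $\delta>0$ there is $C=C(M,\delta)>0$ such that $|S(a)|>C\,n^{2-\delta}$ for every $n\ge1$ and every permutation $a$ of $[n]$ of complexity at most $M$. -/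

import Mathlib

/-- `a` restricted to `[n] = {1, …, n}` is a permutation of `[n]`
(the values of `a` outside `[n]` play no role). -/
def IsPermutationOf (n : ℕ) (a : ℕ → ℕ) : Prop :=
  Set.BijOn a (Set.Icc 1 n) (Set.Icc 1 n)

/-- The set `S(a)` of all distinct sums `a_u + a_{u+1} + ⋯ + a_v` with `1 ≤ u ≤ v ≤ n`. -/
def consecutiveSums (n : ℕ) (a : ℕ → ℕ) : Finset ℕ :=
  ((Finset.Icc 1 n ×ˢ Finset.Icc 1 n).filter (fun p => p.1 ≤ p.2)).image
    (fun p => ∑ i ∈ Finset.Icc p.1 p.2, a i)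

/-- The sequence `a_1, …, a_n` has complexity at most `M`: the set `[n]` is partitioned into
`M` intervals (some may be empty), and on the `j`-th one `a_i = i * b_j + c_j` for real
constants `b_j`, `c_j` with `|b_j| ≤ M`. -/
def HasComplexityAtMost (M n : ℕ) (a : ℕ → ℕ) : Prop :=
  ∃ (I : Fin M → Finset ℕ) (b c : Fin M → ℝ),
    (∀ j, ∃ p q : ℕ, I j = Finset.Icc p q) ∧
    (∀ j k, j ≠ k → Disjoint (I j) (I k)) ∧
    Finset.univ.biUnion I = Finset.Icc 1 n ∧
    (∀ j, |b j| ≤ (M : ℝ)) ∧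
    (∀ j, ∀ i ∈ I j, (a i : ℝ) = (i : ℝ) * b j + c j)

/-! Lower bound. Some affine piece has at least n/M elements, hence contains at least n²/(2M²) pairs
u ≤ v. There, twice a sum m equals its length times a_u + a_v, so the length divides 2m; m and the
length together determine a_u, hence u by injectivity. Each m is thus hit at most d(2m) times, which
is O(n^δ) by the divisor bound.

Upper bound. With u in one piece and v in another, of slopes b and b', the sum s is a quadratic in
(u, v) without cross term, and completing the squares gives αs + β = Y² - DX² with D = bb' and X, Y
affine in u and v (`exists_norm_form_eq_sum_Icc`). Turán's method then applies
(`card_image_mul_sum_le`). A prime r divides αs + β for a proportion 1/r of the integers s, but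
divides Y² - DX² for a proportion 1/r + χ(r)(r-1)/r² of the pairs, where χ(r) is the quadratic
character of D mod r. Counting prime divisors with weight χ(r) makes all these biases add up,
whether or not D is a square. So either s is atypical as an integer or (u, v) is atypical as a pair,
and Chebyshev bounds both sets by O(n²/L), L being the sum of 1/r over the primes used. L can be
made arbitrarily large, and there are at most M² pairs of pieces. -/

/-! ### Lower bound: divisor bound and sums inside one affine piece. -/

theorem exists_card_divisors_le_rpow {ε : ℝ} (hε : 0 < ε) :
    ∃ K : ℝ, 0 < K ∧ ∀ n : ℕ, n ≠ 0 → (n.divisors.card : ℝ) ≤ K * (n : ℝ) ^ ε := by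
  -- Primes p ≥ B have p^ε ≥ 2, so e + 1 ≤ 2^e ≤ p^(eε) at no cost; each of the fewer than B + 1
  -- smaller primes costs at most a factor K, chosen so that e + 1 ≤ K(1 + eε log 2).
  obtain ⟨B, hB⟩ := exists_nat_ge ((2 : ℝ) ^ (1 / ε))
  set K : ℝ := 1 + 1 / (ε * Real.log 2) with hK
  have hl : 0 < ε * Real.log 2 := mul_pos hε (Real.log_pos one_lt_two)
  have hK1 : 1 ≤ K := by
    have : 0 < 1 / (ε * Real.log 2) := by positivity
    linarith
  refine ⟨K ^ B, by positivity, fun n hn => ?_⟩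
  have key : ∀ p ∈ n.primeFactors, ((n.factorization p + 1 : ℕ) : ℝ) ≤
      (if p < B then K else 1) * (((p ^ n.factorization p : ℕ) : ℝ)) ^ ε := by
    intro p hp
    have hp2 : (2 : ℝ) ≤ p := by exact_mod_cast (Nat.prime_of_mem_primeFactors hp).two_le
    generalize n.factorization p = e
    have hpe : (((p ^ e : ℕ) : ℝ)) ^ ε = ((p : ℝ) ^ ε) ^ e := by
      rw [Nat.cast_pow, ← Real.rpow_natCast, ← Real.rpow_natCast, ← Real.rpow_mul (by positivity),
        ← Real.rpow_mul (by positivity), mul_comm]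
    rw [hpe]
    split_ifs with h
    · have h1 : (1 + ε * Real.log 2) ≤ (p : ℝ) ^ ε := by
        calc 1 + ε * Real.log 2 ≤ Real.exp (ε * Real.log 2) := by
              linarith [Real.add_one_le_exp (ε * Real.log 2)]
          _ = (2 : ℝ) ^ ε := by rw [Real.rpow_def_of_pos two_pos, mul_comm]
          _ ≤ _ := Real.rpow_le_rpow two_pos.le hp2 hε.le
      have h2 : 1 + e * (ε * Real.log 2) ≤ ((p : ℝ) ^ ε) ^ e :=
        (one_add_mul_le_pow (by linarith) e).trans (pow_le_pow_left₀ (by positivity) h1 e)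
      calc ((e + 1 : ℕ) : ℝ) ≤ K * (1 + e * (ε * Real.log 2)) := by
            have : K * (1 + e * (ε * Real.log 2)) =
              1 + e + e * (ε * Real.log 2) + 1 / (ε * Real.log 2) := by rw [hK]; field_simp; ring
            rw [this]
            push_cast
            have : 0 < 1 / (ε * Real.log 2) := by positivity
            nlinarith [mul_nonneg (Nat.cast_nonneg (α := ℝ) e) hl.le]
        _ ≤ _ := mul_le_mul_of_nonneg_left h2 (by linarith)
    · have h1 : (2 : ℝ) ≤ (p : ℝ) ^ ε := by
        have hBp : (2 : ℝ) ^ (1 / ε) ≤ p := hB.trans (by exact_mod_cast not_lt.mp h)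
        calc (2 : ℝ) = ((2 : ℝ) ^ (1 / ε)) ^ ε := by
              rw [← Real.rpow_mul two_pos.le, one_div_mul_cancel hε.ne', Real.rpow_one]
          _ ≤ _ := Real.rpow_le_rpow (by positivity) hBp hε.le
      rw [one_mul]
      calc ((e + 1 : ℕ) : ℝ) ≤ 2 ^ e := by exact_mod_cast Nat.lt_two_pow_self
        _ ≤ _ := pow_le_pow_left₀ two_pos.le h1 e
  rw [Nat.card_divisors hn, Nat.cast_prod]
  refine (Finset.prod_le_prod (fun _ _ => by positivity) key).trans ?_
  rw [Finset.prod_mul_distrib, Real.finsetProd_rpow _ _ (fun _ _ => by positivity),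
    ← Nat.cast_prod, ← Nat.prod_factorization_eq_prod_primeFactors (f := fun p e => p ^ e), Nat.prod_factorization_pow_eq_self hn]
  refine mul_le_mul_of_nonneg_right ?_ (by positivity)
  rw [Finset.prod_ite, Finset.prod_const, Finset.prod_const_one, mul_one]
  refine pow_le_pow_right₀ hK1 ?_
  calc _ ≤ (Finset.range B).card := Finset.card_le_card fun p => by simp
    _ = B := Finset.card_range B

theorem two_mul_sum_Icc_arithmetic {R : Type*} [CommRing R] (b c : R) {u v : ℕ} (h : u ≤ v) :
    2 * ∑ i ∈ Finset.Icc u v, ((i : R) * b + c) = (v + 1 - u) * (b * (u + v) + 2 * c) := by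
  induction v, h using Nat.le_induction with
  | base => simp; ring
  | succ v h ih =>
    rw [Finset.sum_Icc_succ_top (by omega), mul_add, ih]
    push_cast
    ring

theorem sum_Icc_mem_consecutiveSums {n u v : ℕ} (a : ℕ → ℕ) (hu : 1 ≤ u) (huv : u ≤ v)
    (hv : v ≤ n) : ∑ i ∈ Finset.Icc u v, a i ∈ consecutiveSums n a :=
  Finset.mem_image.mpr ⟨(u, v), by simp; omega, rfl⟩

theorem IsPermutationOf.sum_Icc_le {n u v : ℕ} {a : ℕ → ℕ} (ha : IsPermutationOf n a)
    (hu : 1 ≤ u) (hv : v ≤ n) : ∑ i ∈ Finset.Icc u v, a i ≤ n ^ 2 := by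
  calc _ ≤ (Finset.Icc u v).card • n := Finset.sum_le_card_nsmul _ _ _ fun i hi => by
        have := Finset.mem_Icc.mp hi
        exact (ha.mapsTo ⟨by omega, by omega⟩).2
    _ ≤ n * n := by
        rw [smul_eq_mul]
        exact Nat.mul_le_mul_right _ (by simp; omega)
    _ = n ^ 2 := (sq n).symm

/-- On an interval where the permutation is affine, a sum is determined by its value and length. -/
theorem card_fiber_le_card_divisors {n p q : ℕ} {a : ℕ → ℕ} (ha : IsPermutationOf n a) {b c : ℝ}
    (hI : Finset.Icc p q ⊆ Finset.Icc 1 n)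
    (hab : ∀ i ∈ Finset.Icc p q, (a i : ℝ) = (i : ℝ) * b + c) (m : ℕ) (hm : m ≠ 0) :
    (((Finset.Icc p q ×ˢ Finset.Icc p q).filter (fun x => x.1 ≤ x.2)).filter
      (fun x => ∑ i ∈ Finset.Icc x.1 x.2, a i = m)).card ≤ (2 * m).divisors.card := by
  have formula : ∀ u v : ℕ, p ≤ u → u ≤ v → v ≤ q → ∑ i ∈ Finset.Icc u v, a i = m →
      (2 * m : ℝ) = (v + 1 - u) * (b * (u + v) + 2 * c) := by
    intro u v hu huv hv h
    rw [← two_mul_sum_Icc_arithmetic b c huv, ← h]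
    push_cast
    congr 1
    refine Finset.sum_congr rfl fun i hi => hab i ?_
    simp only [Finset.mem_Icc] at hi ⊢
    omega
  -- Send a pair to its length: a divisor of 2m with cofactor a_u + a_v, from which u can be
  -- recovered.
  refine Finset.card_le_card_of_injOn (fun x => x.2 + 1 - x.1) ?_ ?_
  · rintro ⟨u, v⟩ hx
    simp only [Finset.coe_filter, Finset.mem_filter, Finset.mem_product, Finset.mem_Icc,
      Set.mem_ofPred_eq] at hx
    obtain ⟨⟨⟨⟨h1, h2⟩, h3, h4⟩, h5⟩, h6⟩ := hx
    simp only [Finset.mem_coe, Nat.mem_divisors]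
    refine ⟨⟨a u + a v, ?_⟩, by omega⟩
    have := formula u v h1 h5 h4 h6
    rify [show u ≤ v + 1 by omega]
    rw [this, hab u (by simp; omega), hab v (by simp; omega)]
    ring
  · rintro ⟨u, v⟩ hx ⟨u', v'⟩ hx' hl
    simp only [Finset.coe_filter, Finset.mem_filter, Finset.mem_product, Finset.mem_Icc,
      Set.mem_ofPred_eq] at hx hx' hl
    obtain ⟨⟨⟨⟨h1, h2⟩, h3, h4⟩, h5⟩, h6⟩ := hx
    obtain ⟨⟨⟨⟨h1', h2'⟩, h3', h4'⟩, h5'⟩, h6'⟩ := hx'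
    have e1 := formula u v h1 h5 h4 h6
    have e2 := formula u' v' h1' h5' h4' h6'
    have hl' : (v + 1 - u : ℝ) = v' + 1 - u' := by
      have : (v : ℤ) + 1 - u = v' + 1 - u' := by omega
      exact_mod_cast this
    have hpos : (0 : ℝ) < v + 1 - u := by
      have : (u : ℝ) ≤ v := by exact_mod_cast h5
      linarith
    have hau : a u = a u' := by
      have hs : (v + 1 - u : ℝ) * (b * (u - u')) = 0 := by
        have hv' : (v' : ℝ) = v - u + u' := by linarith
        rw [← hl', e1, hv'] at e2
        nlinarith
      have : b * (u - u') = 0 := (mul_eq_zero.mp hs).resolve_left hpos.ne'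
      have h : (a u : ℝ) = a u' := by
        rw [hab u (by simp; omega), hab u' (by simp; omega)]
        linarith
      exact_mod_cast h
    have hmem : ∀ w, p ≤ w → w ≤ q → w ∈ Set.Icc 1 n := fun w hw hw' => by
      have := hI (Finset.mem_Icc.mpr ⟨hw, hw'⟩)
      simpa using this
    have := ha.injOn (hmem u h1 h2) (hmem u' h1' h2') hau
    simp only [Prod.mk.injEq]
    omega

theorem sq_card_le_two_mul_card_filter_le (I : Finset ℕ) :
    I.card ^ 2 ≤ 2 * ((I ×ˢ I).filter (fun x => x.1 ≤ x.2)).card := by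
  set T := (I ×ˢ I).filter (fun x => x.1 ≤ x.2)
  have : I ×ˢ I ⊆ T ∪ T.image Prod.swap := by
    rintro ⟨u, v⟩ h
    have h' := Finset.mem_product.mp h
    simp only [Finset.mem_union, Finset.mem_image, T, Finset.mem_filter, Finset.mem_product]
    rcases le_total u v with huv | huv
    · exact Or.inl ⟨h', huv⟩
    · exact Or.inr ⟨(v, u), ⟨⟨h'.2, h'.1⟩, huv⟩, rfl⟩
  calc I.card ^ 2 = (I ×ˢ I).card := by rw [Finset.card_product, sq]
    _ ≤ _ := Finset.card_le_card this
    _ ≤ T.card + (T.image Prod.swap).card := Finset.card_union_le _ _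
    _ ≤ T.card + T.card := Nat.add_le_add_left Finset.card_image_le _
    _ = 2 * T.card := (two_mul _).symm

theorem exists_lt_card_consecutiveSums (M : ℕ) {δ : ℝ} (hδ : 0 < δ) :
    ∃ C : ℝ, 0 < C ∧ ∀ n : ℕ, 1 ≤ n → ∀ a : ℕ → ℕ,
      IsPermutationOf n a → HasComplexityAtMost M n a →
        C * (n : ℝ) ^ (2 - δ) < ((consecutiveSums n a).card : ℝ) := by
  obtain ⟨K, hK, hdiv⟩ := exists_card_divisors_le_rpow (half_pos hδ)
  set K' := K * (2 : ℝ) ^ (δ / 2) with hK'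
  have hK'0 : 0 < K' := by positivity
  -- M + 1 keeps the constant positive when M = 0; 4 in place of 2 makes the final inequality
  -- strict.
  refine ⟨1 / (4 * ((M : ℝ) + 1) ^ 2 * K'), by positivity, fun n hn a ha hc => ?_⟩
  obtain ⟨I, b, c, hI, -, hU, -, hab⟩ := hc
  obtain ⟨j, hj⟩ : ∃ j, n ≤ M * (I j).card := by
    by_contra! h
    have h1 : n ≤ ∑ j, (I j).card := by
      calc n = (Finset.univ.biUnion I).card := by rw [hU]; simp
        _ ≤ _ := Finset.card_biUnion_le
    have h2 : M * ∑ j, (I j).card ≤ M * (n - 1) := by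
      rw [Finset.mul_sum]
      calc _ ≤ ∑ _j : Fin M, (n - 1) := Finset.sum_le_sum fun j _ => by have := h j; omega
        _ = _ := by simp
    rcases Nat.eq_zero_or_pos M with rfl | hM
    · simp at h1; omega
    · have := Nat.le_of_mul_le_mul_left h2 hM
      omega
  obtain ⟨p, q, hpq⟩ := hI j
  have hsub : Finset.Icc p q ⊆ Finset.Icc 1 n := by
    rw [← hpq, ← hU]
    exact Finset.subset_biUnion_of_mem I (Finset.mem_univ j)
  have hbd : ∀ u v, p ≤ u → u ≤ q → p ≤ v → v ≤ q → 1 ≤ u ∧ v ≤ n := fun u v h1 h2 h3 h4 =>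
    ⟨(Finset.mem_Icc.mp (hsub (Finset.mem_Icc.mpr ⟨h1, h2⟩))).1,
      (Finset.mem_Icc.mp (hsub (Finset.mem_Icc.mpr ⟨h3, h4⟩))).2⟩
  set T := (Finset.Icc p q ×ˢ Finset.Icc p q).filter (fun x => x.1 ≤ x.2) with hT
  have hmaps : ∀ x ∈ T, ∑ i ∈ Finset.Icc x.1 x.2, a i ∈ consecutiveSums n a := by
    rintro ⟨u, v⟩ hx
    simp only [hT, Finset.mem_filter, Finset.mem_product, Finset.mem_Icc] at hx
    have := hbd u v hx.1.1.1 hx.1.1.2 hx.1.2.1 hx.1.2.2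
    exact sum_Icc_mem_consecutiveSums a this.1 hx.2 this.2
  have hn0 : (0 : ℝ) < n := by exact_mod_cast hn
  have hT1 : (T.card : ℝ) ≤ (consecutiveSums n a).card * (K' * (n : ℝ) ^ δ) := by
    rw [Finset.card_eq_sum_card_fiberwise hmaps]
    push_cast
    rw [← nsmul_eq_mul]
    refine Finset.sum_le_card_nsmul _ _ _ fun m hm => ?_
    obtain ⟨⟨u, v⟩, huv, rfl⟩ := Finset.mem_image.mp hm
    simp only [Finset.mem_filter, Finset.mem_product, Finset.mem_Icc] at huv
    have hm0 : ∑ i ∈ Finset.Icc u v, a i ≠ 0 := by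
      have h1 : a u ≤ ∑ i ∈ Finset.Icc u v, a i :=
        Finset.single_le_sum (f := a) (fun _ _ => Nat.zero_le _) (Finset.mem_Icc.mpr ⟨le_rfl, huv.2⟩)
      have h2 : 1 ≤ a u := (ha.mapsTo ⟨huv.1.1.1, huv.1.1.2⟩).1
      omega
    have hm1 := ha.sum_Icc_le huv.1.1.1 huv.1.2.2
    simp only
    generalize ∑ i ∈ Finset.Icc u v, a i = m at hm0 hm1
    have hfib := card_fiber_le_card_divisors ha hsub (fun i hi => hab j i (hpq ▸ hi)) m hm0
    calc _ ≤ ((2 * m).divisors.card : ℝ) := by exact_mod_cast hfib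
      _ ≤ K * ((2 * m : ℕ) : ℝ) ^ (δ / 2) := hdiv _ (by omega)
      _ ≤ K * (2 * (n : ℝ) ^ (2 : ℝ)) ^ (δ / 2) := by
        refine mul_le_mul_of_nonneg_left (Real.rpow_le_rpow (by positivity) ?_ (by positivity)) hK.le
        rw [Real.rpow_two]
        exact_mod_cast Nat.mul_le_mul_left 2 hm1
      _ = K' * (n : ℝ) ^ δ := by
        rw [Real.mul_rpow (by positivity) (by positivity), ← Real.rpow_mul hn0.le, hK', ← mul_assoc]
        congr 2
        ring
  have hT2 : ((n : ℝ)) ^ 2 ≤ 2 * M ^ 2 * T.card := by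
    have h1 := sq_card_le_two_mul_card_filter_le (Finset.Icc p q)
    have h2 : n ^ 2 ≤ (M * (Finset.Icc p q).card) ^ 2 := Nat.pow_le_pow_left (hpq ▸ hj) 2
    have : n ^ 2 ≤ 2 * M ^ 2 * T.card := by
      calc n ^ 2 ≤ M ^ 2 * (Finset.Icc p q).card ^ 2 := by rw [← mul_pow]; exact h2
        _ ≤ M ^ 2 * (2 * T.card) := Nat.mul_le_mul_left _ h1
        _ = _ := by ring
    exact_mod_cast this
  have hnd : (0 : ℝ) < (n : ℝ) ^ δ := by positivity
  rw [Real.rpow_sub hn0, Real.rpow_two, div_mul_div_comm, one_mul, div_lt_iff₀ (by positivity)]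
  have hn2 : (0 : ℝ) < (n : ℝ) ^ 2 := by positivity
  set S : ℝ := ((consecutiveSums n a).card : ℝ)
  have hS : 0 ≤ S * (K' * (n : ℝ) ^ δ) := by positivity
  have hM : (M : ℝ) ^ 2 ≤ ((M : ℝ) + 1) ^ 2 := by
    have : (0 : ℝ) ≤ M := by positivity
    nlinarith
  have h3 : (n : ℝ) ^ 2 ≤ 2 * (((M : ℝ) + 1) ^ 2 * (S * (K' * (n : ℝ) ^ δ))) := by
    calc _ ≤ _ := hT2
      _ ≤ 2 * (M : ℝ) ^ 2 * (S * (K' * (n : ℝ) ^ δ)) := by gcongr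
      _ ≤ _ := by rw [mul_assoc]; gcongr
  calc (n : ℝ) ^ 2 < 2 * (n : ℝ) ^ 2 := by linarith
    _ ≤ 2 * (2 * (((M : ℝ) + 1) ^ 2 * (S * (K' * (n : ℝ) ^ δ)))) := by linarith
    _ = _ := by ring

/-! ### Second moments on finite product spaces. -/

section SecondMoment

variable {ι : Type*} [Fintype ι] [DecidableEq ι] {Ω : ι → Type*} [∀ i, Fintype (Ω i)]

theorem sum_pi_apply (i : ι) (g : Ω i → ℝ) [Nonempty (Ω i)] :
    ∑ ω : ∀ i, Ω i, g (ω i) = Fintype.card (∀ i, Ω i) * ((∑ x, g x) / Fintype.card (Ω i)) := by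
  have hc := Fintype.card_congr (Equiv.piSplitAt i Ω)
  rw [Fintype.card_prod] at hc
  rw [← (Equiv.piSplitAt i Ω).symm.sum_comp, Fintype.sum_prod_type, hc]
  have : (Fintype.card (Ω i) : ℝ) ≠ 0 := by simp
  simp [Equiv.piSplitAt, ← Finset.mul_sum]
  field_simp

theorem sum_pi_mul_eq_zero {i j : ι} (hij : j ≠ i) (f : Ω i → ℝ) (g : Ω j → ℝ)
    (hf : ∑ x, f x = 0) : ∑ ω : ∀ i, Ω i, f (ω i) * g (ω j) = 0 := by
  rw [← (Equiv.piSplitAt i Ω).symm.sum_comp, Fintype.sum_prod_type_right]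
  refine Finset.sum_eq_zero fun r _ => ?_
  simp [Equiv.piSplitAt, hij, ← Finset.sum_mul, hf]

/-- Distinct coordinates are independent and centred, so the cross terms vanish. -/
theorem sum_pi_sum_sq [∀ i, Nonempty (Ω i)] (f : ∀ i, Ω i → ℝ) (hf : ∀ i, ∑ x, f i x = 0) :
    ∑ ω : ∀ i, Ω i, (∑ i, f i (ω i)) ^ 2 =
      Fintype.card (∀ i, Ω i) * ∑ i, (∑ x, f i x ^ 2) / Fintype.card (Ω i) := by
  simp_rw [sq, Finset.sum_mul_sum]
  rw [Finset.sum_comm, Finset.mul_sum]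
  refine Finset.sum_congr rfl fun i _ => ?_
  rw [Finset.sum_comm, Finset.sum_eq_single i]
  · exact sum_pi_apply i fun x => f i x * f i x
  · exact fun j _ hj => sum_pi_mul_eq_zero hj _ _ (hf i)
  · simp

/-- Chebyshev's inequality for a signed count of independent events. -/
theorem card_deviation_mul_sq_le [∀ i, Nonempty (Ω i)] (A : ∀ i, Ω i → Prop)
    [∀ i, DecidablePred (A i)] (χ π : ι → ℝ) (hχ : ∀ i, χ i ^ 2 ≤ 1)
    (hπ : ∀ i, (Fintype.card {x // A i x} : ℝ) = π i * Fintype.card (Ω i)) {T : ℝ} (hT : 0 ≤ T) :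
    ((Finset.univ.filter fun ω : ∀ i, Ω i =>
      T ≤ |∑ i, χ i * ((if A i (ω i) then 1 else 0) - π i)|).card : ℝ) * T ^ 2 ≤
        Fintype.card (∀ i, Ω i) * ∑ i, π i := by
  set f : ∀ i, Ω i → ℝ := fun i x => χ i * ((if A i x then 1 else 0) - π i) with hfdef
  have hA : ∀ i, (∑ x : Ω i, if A i x then (1 : ℝ) else 0) = π i * Fintype.card (Ω i) := fun i => by
    rw [← hπ i, Finset.sum_boole, Fintype.card_subtype]
  have hf : ∀ i, ∑ x, f i x = 0 := fun i => by
    rw [hfdef, ← Finset.mul_sum, Finset.sum_sub_distrib, hA]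
    simp
    right; ring
  calc _ ≤ ∑ ω : ∀ i, Ω i, (∑ i, f i (ω i)) ^ 2 := by
        rw [← nsmul_eq_mul]
        refine (Finset.card_nsmul_le_sum _ _ _ fun ω hω => ?_).trans
          (Finset.sum_le_sum_of_subset_of_nonneg (Finset.filter_subset _ _) fun _ _ _ => sq_nonneg _)
        rw [← sq_abs (∑ i, f i (ω i))]
        exact pow_le_pow_left₀ hT (Finset.mem_filter.mp hω).2 2
    _ = _ := sum_pi_sum_sq f hf
    _ ≤ _ := by
        refine mul_le_mul_of_nonneg_left (Finset.sum_le_sum fun i _ => ?_) (by positivity)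
        have hc : (0 : ℝ) < Fintype.card (Ω i) := by exact_mod_cast Fintype.card_pos
        have hp : 0 ≤ π i * Fintype.card (Ω i) := by rw [← hπ]; positivity
        rw [div_le_iff₀ hc]
        -- The variance of an indicator is π - π² ≤ π.
        have e : ∑ x, f i x ^ 2 = χ i ^ 2 * (π i * Fintype.card (Ω i) - π i ^ 2 * Fintype.card (Ω i)) := by
          have : ∀ x, f i x ^ 2 =
              χ i ^ 2 * ((1 - 2 * π i) * (if A i x then 1 else 0) + π i ^ 2) := fun x => by
            simp only [hfdef]
            split_ifs <;> ring
          simp_rw [this]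
          rw [← Finset.mul_sum, Finset.sum_add_distrib, ← Finset.mul_sum, hA]
          simp
          left; ring
        rw [e]
        have h1 : 0 ≤ χ i ^ 2 * (π i ^ 2 * Fintype.card (Ω i)) := by positivity
        nlinarith [mul_nonneg (sub_nonneg.mpr (hχ i)) hp]

end SecondMoment

/-! ### From residue vectors to integers, by the Chinese remainder theorem. -/

section Residues

variable {ι : Type*} [Fintype ι] {p : ι → ℕ} [hp : ∀ i, Fact (p i).Prime]

/-- The primes are distinct, so a residue vector fixes m modulo their product. -/
theorem card_residues_eq_le (hinj : Function.Injective p) (N : ℕ) (ω : ∀ i, ZMod (p i)) :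
    ((Finset.range N).filter fun m => ∀ i, (m : ZMod (p i)) = ω i).card ≤ N / (∏ i, p i) + 1 := by
  rcases Finset.eq_empty_or_nonempty
    ((Finset.range N).filter fun m => ∀ i, (m : ZMod (p i)) = ω i) with h | ⟨m₀, h₀⟩
  · rw [h]; simp
  have h₀' := (Finset.mem_filter.mp h₀).2
  have hQ : 0 < ∏ i, p i := Finset.prod_pos fun i _ => (hp i).out.pos
  calc _ ≤ ((Finset.range N).filter fun m => m ≡ m₀ [MOD ∏ i, p i]).card := by
        refine Finset.card_le_card fun m hm => ?_
        rw [Finset.mem_filter] at hm ⊢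
        refine ⟨hm.1, (Nat.modEq_iff_dvd.mpr ?_).symm⟩
        push_cast
        refine Finset.prod_dvd_of_coprime (fun i _ j _ hij => ?_) fun i _ => ?_
        · exact Nat.isCoprime_iff_coprime.mpr
            ((Nat.coprime_primes (hp i).out (hp j).out).mpr (hinj.ne hij))
        · rw [← ZMod.intCast_zmod_eq_zero_iff_dvd]
          push_cast
          rw [hm.2 i, h₀' i, sub_self]
    _ = N.count (· ≡ m₀ [MOD ∏ i, p i]) := (Nat.count_eq_card_filter_range _ _).symm
    _ ≤ _ := by
        rw [Nat.count_modEq_card _ hQ]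
        split_ifs <;> omega

theorem card_filter_residues_le (hinj : Function.Injective p) (N : ℕ)
    (B : Finset (∀ i, ZMod (p i))) [DecidablePred fun m : ℕ => (fun i => (m : ZMod (p i))) ∈ B] :
    ((Finset.range N).filter fun m : ℕ => (fun i => (m : ZMod (p i))) ∈ B).card ≤
      (N / (∏ i, p i) + 1) * B.card := by
  classical
  refine Finset.card_le_mul_card_image_of_maps_to (f := fun (m : ℕ) i => (m : ZMod (p i)))
    (fun m hm => (Finset.mem_filter.mp hm).2) _ fun ω _ => ?_
  refine le_trans (Finset.card_le_card fun m hm => ?_) (card_residues_eq_le hinj N ω)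
  simp only [Finset.mem_filter] at hm ⊢
  exact ⟨hm.1.1, fun i => congrFun hm.2 i⟩

theorem card_filter_residues_prod_le (hinj : Function.Injective p) (N : ℕ)
    (B : Finset (∀ i, ZMod (p i) × ZMod (p i)))
    [DecidablePred fun x : ℕ × ℕ => (fun i => ((x.1 : ZMod (p i)), (x.2 : ZMod (p i)))) ∈ B] :
    ((Finset.range N ×ˢ Finset.range N).filter fun x : ℕ × ℕ =>
      (fun i => ((x.1 : ZMod (p i)), (x.2 : ZMod (p i)))) ∈ B).card ≤
      (N / (∏ i, p i) + 1) ^ 2 * B.card := by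
  classical
  refine Finset.card_le_mul_card_image_of_maps_to
    (f := fun (x : ℕ × ℕ) i => ((x.1 : ZMod (p i)), (x.2 : ZMod (p i))))
    (fun m hm => (Finset.mem_filter.mp hm).2) _ fun ω _ => ?_
  rw [sq]
  refine le_trans (Finset.card_le_card ?_) ((Finset.card_product _ _).trans_le
    (Nat.mul_le_mul (card_residues_eq_le hinj N fun i => (ω i).1)
      (card_residues_eq_le hinj N fun i => (ω i).2)))
  intro x hx
  simp only [Finset.mem_filter, Finset.mem_product] at hx ⊢
  exact ⟨⟨hx.1.1.1, fun i => congrArg Prod.fst (congrFun hx.2 i)⟩,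
    ⟨hx.1.1.2, fun i => congrArg Prod.snd (congrFun hx.2 i)⟩⟩

end Residues

/-! ### Zeros of the linear and quadratic forms over a finite field. -/

section LocalCounts

variable {F : Type*} [Field F] [Fintype F] [DecidableEq F]

theorem card_affine_eq_zero {α : F} (hα : α ≠ 0) (β : F) :
    Fintype.card {x : F // α * x + β = 0} = 1 := by
  rw [Fintype.card_eq_one_iff]
  refine ⟨⟨-β / α, by field_simp; ring⟩, fun ⟨x, hx⟩ => Subtype.ext ?_⟩
  rw [eq_div_iff hα]
  linear_combination hx

/-- Fibre over x: only y = 0 at x = 0, and 1 + χ(D) square roots of Dx² otherwise. -/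
theorem card_sq_eq_mul_sq (hF : ringChar F ≠ 2) (D : F) :
    (Fintype.card {z : F × F // z.2 ^ 2 = D * z.1 ^ 2} : ℤ) =
      Fintype.card F + quadraticChar F D * (Fintype.card F - 1) := by
  have h1 : Fintype.card {z : F × F // z.2 ^ 2 = D * z.1 ^ 2} =
      ∑ x : F, Fintype.card {y : F // y ^ 2 = D * x ^ 2} := by
    rw [← Fintype.card_sigma]
    exact Fintype.card_congr
      { toFun := fun z => ⟨z.1.1, z.1.2, z.2⟩
        invFun := fun z => ⟨(z.1, z.2.1), z.2.2⟩
        left_inv := fun _ => rfl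
        right_inv := fun _ => rfl }
  have h2 : ∀ x : F, (Fintype.card {y : F // y ^ 2 = D * x ^ 2} : ℤ) =
      if x = 0 then 1 else quadraticChar F D + 1 := fun x => by
    have := quadraticChar_card_sqrts hF (D * x ^ 2)
    rw [Set.toFinset_card] at this
    rw [show Fintype.card {y : F // y ^ 2 = D * x ^ 2} =
      Fintype.card {y : F | y ^ 2 = D * x ^ 2} from Fintype.card_congr (Equiv.refl _), this]
    split_ifs with hx
    · simp [hx]
    · rw [map_mul, quadraticChar_sq_one' hx, mul_one]
  rw [h1]
  push_cast
  simp_rw [h2]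
  rw [Finset.sum_ite]
  have h3 : (Finset.univ.filter fun x : F => ¬ x = 0).card + 1 = Fintype.card F := by
    rw [← Finset.card_univ, ← Finset.card_filter_add_card_filter_not (s := Finset.univ) fun x : F => x = 0]
    simp [Finset.filter_eq', add_comm]
  rw [← h3]
  simp [Finset.filter_eq']
  ring

theorem card_affine_sq_eq_mul_affine_sq (hF : ringChar F ≠ 2) (D : F) {γ η : F}
    (hγ : γ ≠ 0) (hη : η ≠ 0) (κ θ : F) :
    (Fintype.card {z : F × F // (γ * z.2 + κ) ^ 2 = D * (η * z.1 + θ) ^ 2} : ℤ) =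
      Fintype.card F + quadraticChar F D * (Fintype.card F - 1) := by
  rw [← card_sq_eq_mul_sq hF D]
  congr 1
  refine Fintype.card_congr
    { toFun := fun z => ⟨(η * z.1.1 + θ, γ * z.1.2 + κ), z.2⟩
      invFun := fun z => ⟨((z.1.1 - θ) / η, (z.1.2 - κ) / γ), ?_⟩
      left_inv := fun z => ?_
      right_inv := fun z => ?_ }
  · have := z.2
    field_simp
    simpa using this
  · ext <;> simp [hη, hγ]
  · ext <;> simp <;> field_simp <;> ring

end LocalCounts

/-! ### Divergence of the sum of reciprocals of primes. -/

theorem exists_primes_sum_one_div_ge (K : ℕ) (R : ℝ) :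
    ∃ P : Finset ℕ, (∀ p ∈ P, p.Prime ∧ K < p) ∧ R ≤ ∑ p ∈ P, (1 : ℝ) / p := by
  have h := (not_summable_iff_tendsto_nat_atTop_of_nonneg
    (fun n => Set.indicator_nonneg (fun _ _ => by positivity) n)).mp not_summable_one_div_on_primes
  -- The extra K + 1 pays for the discarded primes up to K, each contributing at most 1.
  obtain ⟨N, hN⟩ := (h.eventually_ge_atTop (R + (K + 1))).exists
  refine ⟨(Finset.range N).filter fun p => p.Prime ∧ K < p,
    fun p hp => (Finset.mem_filter.mp hp).2, ?_⟩
  have h1 : ∑ p ∈ Finset.range N, Set.indicator {p : ℕ | p.Prime} (fun n : ℕ => (1 : ℝ) / n) p ≤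
      (∑ p ∈ Finset.range N, if p.Prime ∧ K < p then (1 : ℝ) / p else 0) +
        ∑ p ∈ Finset.range N, if p ∈ Finset.range (K + 1) then (1 : ℝ) else 0 := by
    rw [← Finset.sum_add_distrib]
    refine Finset.sum_le_sum fun p _ => ?_
    by_cases hp : p.Prime
    · rw [Set.indicator_of_mem (by exact hp)]
      by_cases hK : K < p
      · rw [if_pos ⟨hp, hK⟩]
        split_ifs <;> linarith
      · rw [if_neg (fun h => hK h.2), if_pos (by simp; omega), zero_add]
        have : (1 : ℝ) ≤ p := by exact_mod_cast hp.one_lt.le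
        exact (div_le_one (by linarith)).mpr this
    · rw [Set.indicator_of_notMem (by exact hp)]
      positivity
  have h2 : (∑ p ∈ Finset.range N, if p ∈ Finset.range (K + 1) then (1 : ℝ) else 0) ≤ K + 1 := by
    rw [Finset.sum_ite_mem, Finset.sum_const, nsmul_eq_mul, mul_one]
    have : (Finset.range N ∩ Finset.range (K + 1)).card ≤ K + 1 := by
      calc _ ≤ (Finset.range (K + 1)).card := Finset.card_le_card Finset.inter_subset_right
        _ = _ := by simp
    exact_mod_cast this
  rw [Finset.sum_filter]
  linarith

/-! ### Turán's argument for the norm form. -/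

section NormForm

variable {ι : Type*} [Fintype ι] {p : ι → ℕ} [hp : ∀ i, Fact (p i).Prime]

/-- Turán's method: a quadratic polynomial in two variables takes few distinct values, because
its values are divisible by primes with a frequency different from that of the integers. -/
theorem card_image_mul_sum_le (hinj : Function.Injective p) (h2 : ∀ i, p i ≠ 2)
    {α β γ κ η θ D : ℤ} (hα : ∀ i, (α : ZMod (p i)) ≠ 0) (hγ : ∀ i, (γ : ZMod (p i)) ≠ 0)
    (hη : ∀ i, (η : ZMod (p i)) ≠ 0) (hD : ∀ i, (D : ZMod (p i)) ≠ 0)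
    {N : ℕ} (hQ : ∏ i, p i ≤ N) (X : Finset (ℕ × ℕ)) (f : ℕ × ℕ → ℕ)
    (hX : X ⊆ Finset.range N ×ˢ Finset.range N) (hf : ∀ x ∈ X, f x < N ^ 2)
    (hid : ∀ x ∈ X, α * (f x : ℤ) + β = (γ * x.2 + κ) ^ 2 - D * (η * x.1 + θ) ^ 2) :
    ((X.image f).card : ℝ) * ∑ i, (1 : ℝ) / p i ≤ 160 * (N : ℝ) ^ 2 := by
  classical
  set L : ℝ := ∑ i, (1 : ℝ) / p i with hL
  have hp2 : ∀ i, (2 : ℝ) ≤ p i := fun i => by exact_mod_cast (hp i).out.two_le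
  have hL0 : 0 ≤ L := Finset.sum_nonneg fun i _ => by positivity
  rcases hL0.eq_or_lt with hL0 | hL0
  · rw [← hL0]; simp
  have hQ0 : 0 < ∏ i, p i := Finset.prod_pos fun i _ => (hp i).out.pos
  set Q := ∏ i, p i with hQdef
  set χ : ι → ℝ := fun i => ((quadraticChar (ZMod (p i)) (D : ZMod (p i)) : ℤ) : ℝ) with hχdef
  have hχ : ∀ i, χ i ^ 2 = 1 := fun i => by
    simp only [hχdef]
    exact_mod_cast quadraticChar_sq_one (hD i)
  have hχ1 : ∀ i, χ i ≤ 1 := fun i => by nlinarith [hχ i, sq_nonneg (χ i - 1)]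
  set π : ι → ℝ := fun i => (p i + χ i * (p i - 1)) / (p i : ℝ) ^ 2 with hπdef
  -- Gap between the two weighted means: χ(π - 1/p) = (p-1)/p² because χ² = 1.
  set Δ : ℝ := ∑ i, ((p i : ℝ) - 1) / (p i : ℝ) ^ 2 with hΔ
  have hΔL : L / 2 ≤ Δ := by
    rw [hL, hΔ, Finset.sum_div]
    refine Finset.sum_le_sum fun i _ => ?_
    have := hp2 i
    rw [div_div, div_le_div_iff₀ (by positivity) (by positivity)]
    nlinarith
  -- Since Δ ≥ L/2, deviations both below L/4 are incompatible with the same weighted divisor count.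
  set T : ℝ := L / 4 with hT
  have hT0 : 0 < T := by positivity
  -- deviations on the two product spaces
  set A₁ : ∀ i, ZMod (p i) → Prop := fun i x => (α : ZMod (p i)) * x + β = 0 with hA₁
  set A₂ : ∀ i, ZMod (p i) × ZMod (p i) → Prop := fun i z =>
    ((γ : ZMod (p i)) * z.2 + κ) ^ 2 = D * ((η : ZMod (p i)) * z.1 + θ) ^ 2 with hA₂
  set B₁ := Finset.univ.filter fun ω : ∀ i, ZMod (p i) =>
    T ≤ |∑ i, χ i * ((if A₁ i (ω i) then 1 else 0) - 1 / p i)| with hB₁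
  set B₂ := Finset.univ.filter fun ω : ∀ i, ZMod (p i) × ZMod (p i) =>
    T ≤ |∑ i, χ i * ((if A₂ i (ω i) then 1 else 0) - π i)| with hB₂
  have hb₁ : (B₁.card : ℝ) * T ^ 2 ≤ Q * L := by
    have := card_deviation_mul_sq_le A₁ χ (fun i => (1 : ℝ) / p i) (fun i => (hχ i).le) (fun i => by
      have hpi := hp2 i
      rw [show Fintype.card {x // A₁ i x} = 1 from by
        convert card_affine_eq_zero (hα i) (β : ZMod (p i)), ZMod.card]
      field_simp
      simp) hT0.le
    rwa [Fintype.card_pi, Finset.prod_congr rfl fun i _ => ZMod.card (p i)] at this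
  have hb₂ : (B₂.card : ℝ) * T ^ 2 ≤ Q ^ 2 * (2 * L) := by
    have := card_deviation_mul_sq_le A₂ χ π (fun i => (hχ i).le) (fun i => by
      have hpi := hp2 i
      have hc := card_affine_sq_eq_mul_affine_sq (F := ZMod (p i))
        (by rw [ZMod.ringChar_zmod_n]; exact h2 i) (D : ZMod (p i)) (hγ i) (hη i) κ θ
      rw [ZMod.card] at hc
      have hc' : (Fintype.card {z // A₂ i z} : ℤ) =
          p i + quadraticChar (ZMod (p i)) D * (p i - 1) := by convert hc
      have hc'' : (Fintype.card {z // A₂ i z} : ℝ) = p i + χ i * (p i - 1) := by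
        have := congrArg (Int.cast : ℤ → ℝ) hc'
        push_cast at this
        exact this
      rw [hc'', hπdef, Fintype.card_prod, ZMod.card]
      push_cast
      field_simp) hT0.le
    refine this.trans ?_
    have hcard : (Fintype.card (∀ i, ZMod (p i) × ZMod (p i)) : ℝ) = (Q : ℝ) ^ 2 := by
      rw [Fintype.card_pi]
      simp [ZMod.card, hQdef, sq, Finset.prod_mul_distrib]
    rw [hcard]
    refine mul_le_mul_of_nonneg_left ?_ (by positivity)
    rw [hL, Finset.mul_sum]
    refine Finset.sum_le_sum fun i _ => ?_
    have hpi := hp2 i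
    simp only [hπdef]
    rw [mul_one_div, div_le_div_iff₀ (by positivity) (by positivity)]
    nlinarith [mul_le_mul_of_nonneg_right (hχ1 i) (by nlinarith : (0 : ℝ) ≤ (p i - 1) * p i)]
  set C₁ := (Finset.range (N ^ 2)).filter fun m : ℕ => (fun i => (m : ZMod (p i))) ∈ B₁
  set C₂ := (Finset.range N ×ˢ Finset.range N).filter fun x : ℕ × ℕ =>
      (fun i => ((x.1 : ZMod (p i)), (x.2 : ZMod (p i)))) ∈ B₂
  have hcover : X.image f ⊆ C₁ ∪ C₂.image f := by
    intro m hm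
    obtain ⟨x, hx, rfl⟩ := Finset.mem_image.mp hm
    rw [Finset.mem_union]
    by_contra! hcon
    obtain ⟨hn₁, hn₂⟩ := hcon
    have hn₁' : (fun i => (f x : ZMod (p i))) ∉ B₁ := fun h =>
      hn₁ (Finset.mem_filter.mpr ⟨Finset.mem_range.mpr (hf x hx), h⟩)
    have hn₂' : (fun i => ((x.1 : ZMod (p i)), (x.2 : ZMod (p i)))) ∉ B₂ := fun h =>
      hn₂ (Finset.mem_image_of_mem f (Finset.mem_filter.mpr ⟨hX hx, h⟩))
    simp only [hB₁, hB₂, Finset.mem_filter, Finset.mem_univ, true_and, not_le, abs_lt] at hn₁' hn₂'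
    have hiff : ∀ i, A₁ i (f x : ZMod (p i)) ↔ A₂ i ((x.1 : ZMod (p i)), (x.2 : ZMod (p i))) := by
      intro i
      have := congrArg (Int.cast : ℤ → ZMod (p i)) (hid x hx)
      push_cast at this
      simp only [hA₁, hA₂, this, sub_eq_zero]
    have hdiff : (∑ i, χ i * ((if A₁ i (f x : ZMod (p i)) then 1 else 0) - 1 / p i)) -
        (∑ i, χ i * ((if A₂ i ((x.1 : ZMod (p i)), (x.2 : ZMod (p i))) then 1 else 0) - π i)) =
        Δ := by
      rw [← Finset.sum_sub_distrib, hΔ]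
      refine Finset.sum_congr rfl fun i _ => ?_
      have hpi := hp2 i
      simp only [hiff i, hπdef]
      have : ((p i : ℝ) - 1) / (p i : ℝ) ^ 2 = χ i ^ 2 * (((p i : ℝ) - 1) / (p i : ℝ) ^ 2) := by
        rw [hχ, one_mul]
      rw [this]
      field_simp
      ring
    linarith [hn₁'.2, hn₂'.1]
  have hc₁ : (C₁.card : ℝ) * Q ≤ 2 * (N : ℝ) ^ 2 * B₁.card := by
    have h1 : C₁.card ≤ (N ^ 2 / Q + 1) * B₁.card := card_filter_residues_le hinj _ _
    -- Q ≤ N absorbs the incomplete last period, at the cost of a factor 2.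
    have h3 : (N ^ 2 / Q + 1) * Q ≤ 2 * N ^ 2 := by
      have := Nat.div_mul_le_self (N ^ 2) Q
      nlinarith
    have : C₁.card * Q ≤ 2 * N ^ 2 * B₁.card := by
      calc C₁.card * Q ≤ (N ^ 2 / Q + 1) * B₁.card * Q := Nat.mul_le_mul_right _ h1
        _ = (N ^ 2 / Q + 1) * Q * B₁.card := by ring
        _ ≤ _ := Nat.mul_le_mul_right _ h3
    exact_mod_cast this
  have hc₂ : (C₂.card : ℝ) * Q ^ 2 ≤ 4 * (N : ℝ) ^ 2 * B₂.card := by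
    have h1 : C₂.card ≤ (N / Q + 1) ^ 2 * B₂.card := card_filter_residues_prod_le hinj _ _
    have h3 : (N / Q + 1) * Q ≤ 2 * N := by
      have := Nat.div_mul_le_self N Q
      nlinarith
    have : C₂.card * Q ^ 2 ≤ 4 * N ^ 2 * B₂.card := by
      calc C₂.card * Q ^ 2 ≤ (N / Q + 1) ^ 2 * B₂.card * Q ^ 2 := Nat.mul_le_mul_right _ h1
        _ = ((N / Q + 1) * Q) ^ 2 * B₂.card := by ring
        _ ≤ (2 * N) ^ 2 * B₂.card := Nat.mul_le_mul_right _ (Nat.pow_le_pow_left h3 2)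
        _ = _ := by ring
    exact_mod_cast this
  have hQr : (0 : ℝ) < Q := by exact_mod_cast hQ0
  have hd₁ : (C₁.card : ℝ) * L ≤ 32 * (N : ℝ) ^ 2 := by
    have h : (C₁.card : ℝ) * L * (Q * L) ≤ 32 * (N : ℝ) ^ 2 * (Q * L) := by
      calc (C₁.card : ℝ) * L * (Q * L) = 16 * ((C₁.card : ℝ) * Q * T ^ 2) := by rw [hT]; ring
        _ ≤ 16 * (2 * (N : ℝ) ^ 2 * B₁.card * T ^ 2) := by gcongr
        _ = 32 * (N : ℝ) ^ 2 * (B₁.card * T ^ 2) := by ring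
        _ ≤ _ := by gcongr
    exact le_of_mul_le_mul_right h (by positivity)
  have hd₂ : (C₂.card : ℝ) * L ≤ 128 * (N : ℝ) ^ 2 := by
    have h : (C₂.card : ℝ) * L * (Q ^ 2 * L) ≤ 128 * (N : ℝ) ^ 2 * (Q ^ 2 * L) := by
      calc (C₂.card : ℝ) * L * (Q ^ 2 * L) = 16 * ((C₂.card : ℝ) * Q ^ 2 * T ^ 2) := by rw [hT]; ring
        _ ≤ 16 * (4 * (N : ℝ) ^ 2 * B₂.card * T ^ 2) := by gcongr
        _ = 64 * (N : ℝ) ^ 2 * (B₂.card * T ^ 2) := by ring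
        _ ≤ 64 * (N : ℝ) ^ 2 * (Q ^ 2 * (2 * L)) := by gcongr
        _ = _ := by ring
    exact le_of_mul_le_mul_right h (by positivity)
  have hfinal : ((X.image f).card : ℝ) ≤ C₁.card + C₂.card := by
    exact_mod_cast (Finset.card_le_card hcover).trans
      ((Finset.card_union_le _ _).trans (Nat.add_le_add_left Finset.card_image_le _))
  nlinarith [mul_le_mul_of_nonneg_right hfinal hL0.le]

end NormForm

/-! ### From affine pieces to the norm form. -/

/-- A piece with two points has as slope a difference of consecutive values, an integer that is
nonzero by injectivity. -/
theorem exists_int_affine {M n p q : ℕ} {a : ℕ → ℕ} (ha : IsPermutationOf n a) {b c : ℝ}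
    (hb : |b| ≤ M) (hI : Finset.Icc p q ⊆ Finset.Icc 1 n) (hpq : p < q)
    (hab : ∀ i ∈ Finset.Icc p q, (a i : ℝ) = (i : ℝ) * b + c) :
    ∃ b' c' : ℤ, b' ≠ 0 ∧ b'.natAbs ≤ M ∧
      ∀ i ∈ Finset.Icc p q, (a i : ℤ) = (i : ℤ) * b' + c' := by
  have h1 := hab p (by simp; omega)
  have h2 := hab (p + 1) (by simp; omega)
  push_cast at h2
  have hbr : (((a (p + 1) : ℤ) - a p : ℤ) : ℝ) = b := by push_cast; linarith
  have hcr : (((a p : ℤ) - p * ((a (p + 1) : ℤ) - a p) : ℤ) : ℝ) = c := by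
    rw [← hbr] at h1
    push_cast at h1 ⊢
    linarith
  refine ⟨(a (p + 1) : ℤ) - a p, (a p : ℤ) - p * ((a (p + 1) : ℤ) - a p), fun h0 => ?_, ?_, ?_⟩
  · have hmem : ∀ w, p ≤ w → w ≤ q → w ∈ Set.Icc 1 n := fun w hw hw' => by
      simpa using hI (Finset.mem_Icc.mpr ⟨hw, hw'⟩)
    have := ha.injOn (hmem (p + 1) (by omega) (by omega)) (hmem p le_rfl (by omega)) (by omega)
    omega
  · have : ((((a (p + 1) : ℤ) - a p).natAbs : ℕ) : ℝ) ≤ M := by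
      rwa [Nat.cast_natAbs, Int.cast_abs, hbr]
    exact_mod_cast this
  · intro i hi
    have := hab i hi
    rw [← hbr, ← hcr] at this
    exact_mod_cast this

/-- Everything before the piece enters a prefix sum only through the constant f. A sum from u to v
is a difference of prefix sums, hence has no cross term in u and v. -/
theorem exists_two_mul_sum_range_eq {p q : ℕ} {a : ℕ → ℕ} {b c : ℤ}
    (hab : ∀ i ∈ Finset.Icc p q, (a i : ℤ) = (i : ℤ) * b + c) :
    ∃ f : ℤ, ∀ x ∈ Finset.Icc p q,
      2 * ∑ i ∈ Finset.range (x + 1), (a i : ℤ) = b * x ^ 2 + (b + 2 * c) * x + f := by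
  refine ⟨(1 - p) * (b * p + 2 * c) + 2 * ∑ i ∈ Finset.range p, (a i : ℤ), fun x hx => ?_⟩
  obtain ⟨h1, h2⟩ := Finset.mem_Icc.mp hx
  have h := two_mul_sum_Icc_arithmetic b c h1
  have h3 : ∑ i ∈ Finset.Icc p x, ((i : ℤ) * b + c) = ∑ i ∈ Finset.Ico p (x + 1), (a i : ℤ) := by
    refine Finset.sum_congr (by ext; simp) fun i hi => (hab i ?_).symm
    simp only [Finset.mem_Icc, Finset.mem_Ico] at hi ⊢
    omega
  rw [h3, Finset.sum_Ico_eq_sub _ (by omega)] at h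
  linear_combination h

/-- Completing the square in the sums from one affine piece to another. -/
theorem exists_norm_form_eq_sum_Icc {p q p' q' : ℕ} {a : ℕ → ℕ} {b c b' c' : ℤ}
    (hab : ∀ i ∈ Finset.Icc p q, (a i : ℤ) = (i : ℤ) * b + c)
    (hab' : ∀ i ∈ Finset.Icc p' q', (a i : ℤ) = (i : ℤ) * b' + c') :
    ∃ β κ θ : ℤ, ∀ u ∈ Finset.Icc p q, ∀ v ∈ Finset.Icc p' q', u ≤ v →
      8 * b' * b ^ 2 * ((∑ i ∈ Finset.Icc u v, a i : ℕ) : ℤ) + β =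
        (2 * b' * b * v + κ) ^ 2 - b * b' * (2 * b * u + θ) ^ 2 := by
  obtain ⟨f, hf⟩ := exists_two_mul_sum_range_eq hab
  obtain ⟨f', hf'⟩ := exists_two_mul_sum_range_eq hab'
  refine ⟨(b' + 2 * c') ^ 2 * b ^ 2 - b * b' * (2 * c - b) ^ 2 - 4 * b' * b ^ 2 * (f' - f + 2 * c),
    (b' + 2 * c') * b, 2 * c - b, fun u hu v hv huv => ?_⟩
  have h1 := hf u hu
  have h2 := hf' v hv
  have h3 := hab u hu
  have h4 : ((∑ i ∈ Finset.Icc u v, a i : ℕ) : ℤ) =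
      ∑ i ∈ Finset.range (v + 1), (a i : ℤ) - ∑ i ∈ Finset.range u, (a i : ℤ) := by
    rw [← Finset.sum_Ico_eq_sub _ (by omega)]
    push_cast
    exact Finset.sum_congr (by ext; simp) fun _ _ => rfl
  rw [Finset.sum_range_succ] at h1
  rw [h4]
  linear_combination 4 * b' * b ^ 2 * (h2 - h1 + 2 * h3)

theorem card_image_sum_Icc_le {M n p q p' q' : ℕ} {a : ℕ → ℕ} (ha : IsPermutationOf n a)
    {b c b' c' : ℝ} (hb : |b| ≤ M) (hb' : |b'| ≤ M) (hI : Finset.Icc p q ⊆ Finset.Icc 1 n)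
    (hI' : Finset.Icc p' q' ⊆ Finset.Icc 1 n)
    (hab : ∀ i ∈ Finset.Icc p q, (a i : ℝ) = (i : ℝ) * b + c)
    (hab' : ∀ i ∈ Finset.Icc p' q', (a i : ℝ) = (i : ℝ) * b' + c')
    (P : Finset ℕ) (hP : ∀ r ∈ P, r.Prime ∧ M + 2 < r) (hL : 0 < ∑ r ∈ P, (1 : ℝ) / r)
    (hn : ∏ r ∈ P, r ≤ n) :
    ((((Finset.Icc p q ×ˢ Finset.Icc p' q').filter fun x => x.1 ≤ x.2).image
      fun x => ∑ i ∈ Finset.Icc x.1 x.2, a i).card : ℝ) ≤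
        160 * ((n : ℝ) + 1) ^ 2 / (∑ r ∈ P, (1 : ℝ) / r) + n := by
  have hle : ∀ {s t : ℕ}, Finset.Icc s t ⊆ Finset.Icc 1 n → (Finset.Icc s t).card ≤ n :=
    fun h => (Finset.card_le_card h).trans (by simp)
  have hshort : (Finset.Icc p q).card * (Finset.Icc p' q').card ≤ n →
      ((((Finset.Icc p q ×ˢ Finset.Icc p' q').filter fun x => x.1 ≤ x.2).image
        fun x => ∑ i ∈ Finset.Icc x.1 x.2, a i).card : ℝ) ≤
        160 * ((n : ℝ) + 1) ^ 2 / (∑ r ∈ P, (1 : ℝ) / r) + n := fun h => by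
    have h1 : (((Finset.Icc p q ×ˢ Finset.Icc p' q').filter fun x => x.1 ≤ x.2).image
        fun x => ∑ i ∈ Finset.Icc x.1 x.2, a i).card ≤ n :=
      Finset.card_image_le.trans ((Finset.card_filter_le _ _).trans
        ((Finset.card_product _ _).trans_le h))
    have h2 : (((((Finset.Icc p q ×ˢ Finset.Icc p' q').filter fun x => x.1 ≤ x.2).image
        fun x => ∑ i ∈ Finset.Icc x.1 x.2, a i).card : ℕ) : ℝ) ≤ n := by exact_mod_cast h1
    have h3 : 0 ≤ 160 * ((n : ℝ) + 1) ^ 2 / (∑ r ∈ P, (1 : ℝ) / r) := by positivity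
    linarith
  -- A piece with at most one point need not have an integral slope, but yields at most n sums; this
  -- is the extra term n.
  rcases le_or_gt q p with hpq | hpq
  · exact hshort (by simpa using Nat.mul_le_mul (show (Finset.Icc p q).card ≤ 1 by simp; omega) (hle hI'))
  rcases le_or_gt q' p' with hpq' | hpq'
  · exact hshort (by simpa using Nat.mul_le_mul (hle hI) (show (Finset.Icc p' q').card ≤ 1 by simp; omega))
  obtain ⟨b, c, hb0, hbM, hab⟩ := exists_int_affine ha hb hI hpq hab
  obtain ⟨b', c', hb0', hbM', hab'⟩ := exists_int_affine ha hb' hI' hpq' hab'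
  obtain ⟨β, κ, θ, hid⟩ := exists_norm_form_eq_sum_Icc hab hab'
  have : ∀ r : P, Fact (r : ℕ).Prime := fun r => ⟨(hP r r.2).1⟩
  -- Primes above M + 2 divide none of 2, b, b', so all coefficients of the form are invertible.
  have hne : ∀ (r : P) (z : ℤ), z ≠ 0 → z.natAbs ≤ M + 2 → (z : ZMod (r : ℕ)) ≠ 0 := by
    intro r z hz hzM h
    rw [ZMod.intCast_zmod_eq_zero_iff_dvd] at h
    have := Nat.le_of_dvd (Int.natAbs_pos.mpr hz) (Int.natCast_dvd.mp h)
    have := (hP r r.2).2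
    omega
  have n2 : ∀ r : P, (2 : ZMod (r : ℕ)) ≠ 0 := fun r => by
    simpa using hne r 2 two_ne_zero (by simp)
  have nb : ∀ r : P, (b : ZMod (r : ℕ)) ≠ 0 := fun r => hne r b hb0 (by omega)
  have nb' : ∀ r : P, (b' : ZMod (r : ℕ)) ≠ 0 := fun r => hne r b' hb0' (by omega)
  have key := card_image_mul_sum_le (p := fun r : P => (r : ℕ)) Subtype.val_injective
    (fun r => by have := (hP r r.2).2; omega)
    (α := 8 * b' * b ^ 2) (β := β) (γ := 2 * b' * b) (κ := κ) (η := 2 * b) (θ := θ) (D := b * b')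
    (fun r => by
      push_cast
      rw [show (8 : ZMod (r : ℕ)) = 2 ^ 3 by norm_num]
      exact mul_ne_zero (mul_ne_zero (pow_ne_zero _ (n2 r)) (nb' r)) (pow_ne_zero _ (nb r)))
    (fun r => by push_cast; exact mul_ne_zero (mul_ne_zero (n2 r) (nb' r)) (nb r))
    (fun r => by push_cast; exact mul_ne_zero (n2 r) (nb r))
    (fun r => by push_cast; exact mul_ne_zero (nb r) (nb' r))
    -- With n + 1, indices up to n lie in the range and sums up to n² are below N².
    (N := n + 1) (by rw [Finset.prod_coe_sort P fun r => r]; omega)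
    ((Finset.Icc p q ×ˢ Finset.Icc p' q').filter fun x => x.1 ≤ x.2)
    (fun x => ∑ i ∈ Finset.Icc x.1 x.2, a i)
    (by
      intro x hx
      simp only [Finset.mem_filter, Finset.mem_product] at hx
      have h1 := Finset.mem_Icc.mp (hI hx.1.1)
      have h2 := Finset.mem_Icc.mp (hI' hx.1.2)
      simp only [Finset.mem_product, Finset.mem_range]
      omega)
    (by
      intro x hx
      simp only [Finset.mem_filter, Finset.mem_product] at hx
      have h1 := Finset.mem_Icc.mp (hI hx.1.1)
      have h2 := Finset.mem_Icc.mp (hI' hx.1.2)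
      have := ha.sum_Icc_le h1.1 h2.2
      nlinarith)
    (by
      intro x hx
      simp only [Finset.mem_filter, Finset.mem_product] at hx
      exact hid x.1 hx.1.1 x.2 hx.1.2 hx.2)
  rw [Finset.sum_coe_sort P fun r => (1 : ℝ) / r] at key
  push_cast at key
  have := (le_div_iff₀ hL).mpr key
  have hn0 : (0 : ℝ) ≤ n := by positivity
  linarith

/-! ### Upper bound: summing over pairs of pieces. -/

theorem exists_card_consecutiveSums_le (M : ℕ) {ε : ℝ} (hε : 0 < ε) :
    ∃ N : ℕ, ∀ n : ℕ, N ≤ n → ∀ a : ℕ → ℕ,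
      IsPermutationOf n a → HasComplexityAtMost M n a →
        ((consecutiveSums n a).card : ℝ) ≤ ε * (n : ℝ) ^ 2 := by
  -- 1280 = 160 · 4 · 2: the constant of Turán's bound, (n+1)² ≤ 4n², and half of ε for the main
  -- term; N below gives the other half to the term M²n.
  obtain ⟨P, hP, hR⟩ := exists_primes_sum_one_div_ge (M + 2) (1280 * ((M : ℝ) ^ 2 + 1) / ε)
  obtain ⟨N, hN⟩ := exists_nat_ge (2 * ((M : ℝ) ^ 2 + 1) / ε)
  set L := ∑ r ∈ P, (1 : ℝ) / r with hLdef
  have hL : 0 < L := lt_of_lt_of_le (by positivity) hR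
  refine ⟨N + 1 + ∏ r ∈ P, r, fun n hn a ha hc => ?_⟩
  obtain ⟨I, b, c, hI, -, hU, hb, hab⟩ := hc
  have hsub : ∀ j, I j ⊆ Finset.Icc 1 n := fun j => by
    rw [← hU]
    exact Finset.subset_biUnion_of_mem I (Finset.mem_univ j)
  have hcover : consecutiveSums n a ⊆ (Finset.univ : Finset (Fin M × Fin M)).biUnion fun jk =>
      ((I jk.1 ×ˢ I jk.2).filter fun x => x.1 ≤ x.2).image
        fun x => ∑ i ∈ Finset.Icc x.1 x.2, a i := by
    intro m hm
    obtain ⟨⟨u, v⟩, huv, rfl⟩ := Finset.mem_image.mp hm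
    simp only [Finset.mem_filter, Finset.mem_product, ← hU, Finset.mem_biUnion, Finset.mem_univ,
      true_and] at huv
    obtain ⟨⟨⟨j, hj⟩, k, hk⟩, hle⟩ := huv
    exact Finset.mem_biUnion.mpr ⟨(j, k), Finset.mem_univ _, Finset.mem_image.mpr
      ⟨(u, v), Finset.mem_filter.mpr ⟨Finset.mem_product.mpr ⟨hj, hk⟩, hle⟩, rfl⟩⟩
  have hbound : ((consecutiveSums n a).card : ℝ) ≤
      (M : ℝ) ^ 2 * (160 * ((n : ℝ) + 1) ^ 2 / L + n) := by
    calc ((consecutiveSums n a).card : ℝ) ≤ ∑ jk : Fin M × Fin M,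
          ((((I jk.1 ×ˢ I jk.2).filter fun x => x.1 ≤ x.2).image
            fun x => ∑ i ∈ Finset.Icc x.1 x.2, a i).card : ℝ) := by
          exact_mod_cast (Finset.card_le_card hcover).trans Finset.card_biUnion_le
      _ ≤ (Finset.univ : Finset (Fin M × Fin M)).card • (160 * ((n : ℝ) + 1) ^ 2 / L + n) := by
          refine Finset.sum_le_card_nsmul _ _ _ fun jk _ => ?_
          obtain ⟨p, q, hpq⟩ := hI jk.1
          obtain ⟨p', q', hpq'⟩ := hI jk.2
          have h1 := hsub jk.1
          have h2 := hsub jk.2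
          have h3 := hab jk.1
          have h4 := hab jk.2
          rw [hpq] at h1 h3 ⊢
          rw [hpq'] at h2 h4 ⊢
          exact card_image_sum_Icc_le ha (hb _) (hb _) h1 h2 h3 h4 P hP hL (by omega)
      _ = _ := by simp [nsmul_eq_mul, sq]; ring
  have hn1 : (1 : ℝ) ≤ n := by exact_mod_cast (by omega : 1 ≤ n)
  have hnN : (N : ℝ) ≤ n := by exact_mod_cast (by omega : N ≤ n)
  rw [div_le_iff₀ hε] at hR hN
  have hM : (M : ℝ) ^ 2 ≤ (M : ℝ) ^ 2 + 1 := by linarith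
  have e1 : (M : ℝ) ^ 2 * (160 * ((n : ℝ) + 1) ^ 2 / L) ≤ ε / 2 * (n : ℝ) ^ 2 := by
    rw [← mul_div_assoc, div_le_iff₀ hL]
    have h4 : ((n : ℝ) + 1) ^ 2 ≤ 4 * (n : ℝ) ^ 2 := by nlinarith
    calc (M : ℝ) ^ 2 * (160 * ((n : ℝ) + 1) ^ 2)
        ≤ ((M : ℝ) ^ 2 + 1) * (160 * (4 * (n : ℝ) ^ 2)) := by gcongr
      _ = 1 / 2 * (1280 * ((M : ℝ) ^ 2 + 1)) * (n : ℝ) ^ 2 := by ring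
      _ ≤ 1 / 2 * (L * ε) * (n : ℝ) ^ 2 := by gcongr
      _ = _ := by ring
  have e2 : (M : ℝ) ^ 2 * n ≤ ε / 2 * (n : ℝ) ^ 2 := by
    have : (M : ℝ) ^ 2 ≤ ε / 2 * n := by nlinarith
    nlinarith
  linarith [mul_add ((M : ℝ) ^ 2) (160 * ((n : ℝ) + 1) ^ 2 / L) (n : ℝ)]

theorem mainTheorem9 (M : ℕ) :
    (∀ ε : ℝ, 0 < ε → ∃ N : ℕ, ∀ n : ℕ, N ≤ n → ∀ a : ℕ → ℕ,
      IsPermutationOf n a → HasComplexityAtMost M n a →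
        ((consecutiveSums n a).card : ℝ) ≤ ε * (n : ℝ) ^ 2) ∧
    (∀ δ : ℝ, 0 < δ → ∃ C : ℝ, 0 < C ∧ ∀ n : ℕ, 1 ≤ n → ∀ a : ℕ → ℕ,
      IsPermutationOf n a → HasComplexityAtMost M n a →
        C * (n : ℝ) ^ (2 - δ) < ((consecutiveSums n a).card : ℝ)) :=
  ⟨fun _ hε => exists_card_consecutiveSums_le M hε, fun _ hδ => exists_lt_card_consecutiveSums M hδ⟩
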